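/- Let $S$ be a semigroup with zero. A 0-module over $S$ is an abelian group $A$ with a map $(S\setminus 0)\times A\to A$ such that $s(a+b)=sa+sb$, and $s(ta)=(st)a$ whenever $st\neq 0$. For $n\ge 0$ let $C_0^n(S,A)$ be the group of partial $n$-place maps from $S$ to $A$ defined exactly on the tuples $(x_1,\dots,x_n)$ with $x_1\cdots x_n\ne 0$ (so $C_0^0(S,A)=A$), with coboundary $$(\partial^n f)(x_1,\dots,x_{n+1})=x_1f(x_2,\dots,x_{n+1})+\sum_{i=1}^n(-1)^if(x_1,\dots,x_ix_{i+1},\dots,x_{n+1})+(-1)^{n+1}f(x_1,\dots,x_n),$$ and let $H_0^n(S,A)=\operatorname{Ker}\partial^n/\operatorname{Im}\partial^{n-1}$. The 0-cohomological dimension of $S$ is the least $n$ such that $H_0^{n+1}(S,A)=0$ for every 0-module $A$. A monoid with zero is called 0-free if it is isomorphic to the (Rees) quotient of a free monoid by a nonempty two-sided ideal, or to a free monoid with an adjoined zero. **Theorem 15.** Every 0-free monoid $M$ has 0-cohomological dimension at most $1$; moreover $H_0^n(M,A)=0$ for all $n\ge 2$ and all 0-modules $A$ over $M$. A projective representation of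 $M$ over a field $K$ of degree $n$ is a map $\Gamma:M\to \mathrm{Mat}_nK$ such that (1) $\Gamma(xy)=0\iff\Gamma(x)\Gamma(y)=0$ for all $x,y\in M$, and (2) there is a map $\rho:\{(x,y):\Gamma(xy)\neq 0\}\to K^\times$ with $\Gamma(x)\Gamma(y)=\rho(x,y)\,\Gamma(xy)$ on its domain. Projective representations of infinite degree are defined in the same way, with the algebra $\mathrm{End}_K V$ of a $K$-vector space $V$ in place of $\mathrm{Mat}_nK$. A linear representation is a semigroup homomorphism into the multiplicative semigroup of $\mathrm{Mat}_nK$ (or $\mathrm{End}_KV$), and $\Gamma,\Gamma'$ are equivalent if $\Gamma(x)=c(x)\Gamma'(x)$ for some function $c:M\to K^\times$. **Corollary 7.** Every projective representation of a 0-free monoid $M$ over a field $K$, of finite or infinite degree, is equivalent to a linear one. -/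

import Mathlib

universe u v w k l

/-! ### Ideals, Rees quotients and 0-free monoids -/

/-- `I` is a (nonempty, two-sided) ideal of the semigroup `S`. -/
def IsTwoSidedIdeal {S : Type u} [Mul S] (I : Set S) : Prop :=
  I.Nonempty ∧ ∀ x ∈ I, ∀ s : S, s * x ∈ I ∧ x * s ∈ I

/-- The Rees congruence of an ideal `I`: it collapses `I` to one point and identifies nothing else.
The quotient `(reesCon I hI).Quotient` is the quotient of `S` by the ideal `I`. -/
def reesCon {S : Type u} [Mul S] (I : Set S) (hI : IsTwoSidedIdeal I) : Con S where
  r x y := x = y ∨ (x ∈ I ∧ y ∈ I)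
  iseqv :=
    { refl := fun _ => Or.inl rfl
      symm := by
        rintro x y (h | h)
        · exact Or.inl h.symm
        · exact Or.inr h.symm
      trans := by
        rintro x y z (rfl | h) (rfl | h')
        · exact Or.inl rfl
        · exact Or.inr h'
        · exact Or.inr h
        · exact Or.inr ⟨h.1, h'.2⟩ }
  mul' := by
    rintro a b c d (rfl | h) (rfl | h')
    · exact Or.inl rfl
    · exact Or.inr ⟨(hI.2 _ h'.1 _).1, (hI.2 _ h'.2 _).1⟩
    · exact Or.inr ⟨(hI.2 _ h.1 _).2, (hI.2 _ h.2 _).2⟩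
    · exact Or.inr ⟨(hI.2 _ h.1 _).2, (hI.2 _ h.2 _).2⟩

/-- A monoid with zero is 0-free if it is (isomorphic to) the quotient of a free monoid by an ideal,
or a free monoid with an adjoined zero. -/
def IsZeroFree (M : Type u) [MonoidWithZero M] : Prop :=
  ∃ X : Type v,
    (∃ (I : Set (FreeMonoid X)) (hI : IsTwoSidedIdeal I),
      Nonempty (M ≃* (reesCon I hI).Quotient)) ∨
    Nonempty (M ≃* WithZero (FreeMonoid X))

/-! ### 0-modules and 0-cohomology -/

/-- A 0-module over a semigroup `S` with zero: an abelian group `A` with a map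
`(S \ 0) × A → A`, additive in `A`, such that `s (t a) = (s t) a` whenever `s t ≠ 0`. -/
class ZeroModule (S : Type u) (A : Type w) [SemigroupWithZero S] [AddCommGroup A] where
  /-- the action of the nonzero elements -/
  act : {s : S // s ≠ 0} → A → A
  act_add : ∀ (s : {s : S // s ≠ 0}) (a b : A), act s (a + b) = act s a + act s b
  act_act : ∀ (s t : {s : S // s ≠ 0}) (h : s.1 * t.1 ≠ 0) (a : A),
    act s (act t a) = act ⟨s.1 * t.1, h⟩ a

section Cohomology

variable (S : Type u) [MonoidWithZero S]

/-- The `n`-tuples `(x₁, …, xₙ)` of elements of `S` with `x₁ ⋯ xₙ ≠ 0`; for `n = 0` there is exactly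
one such tuple, the empty one. -/
def ZeroNerve (n : ℕ) : Type u :=
  {x : Fin n → S // n ≠ 0 → (List.ofFn x).prod ≠ 0}

/-- The `n`-dimensional cochains of `S` with values in `A`: the partial `n`-place mappings defined
on the tuples with nonzero product. -/
abbrev ZeroCochain (A : Type w) (n : ℕ) : Type (max u w) :=
  ZeroNerve S n → A

variable {S}

theorem exists_prod_contractNth_mul {n : ℕ} (j : Fin (n + 1)) (x : Fin (n + 1) → S) :
    ∃ c : S, (List.ofFn x).prod = (List.ofFn (j.contractNth (· * ·) x)).prod * c := by
  induction n with
  | zero => exact ⟨x 0, by simp⟩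
  | succ n ih =>
    refine Fin.cases ?_ (fun i => ?_) j
    · refine ⟨1, ?_⟩
      have h : ∀ i : Fin n, (0 : Fin (n + 2)).contractNth (· * ·) x i.succ = x i.succ.succ :=
        fun i => Fin.contractNth_apply_of_gt _ _ _ _ (by simp)
      have h0 : (0 : Fin (n + 2)).contractNth (· * ·) x 0 = x 0 * x 1 :=
        Fin.contractNth_apply_of_eq _ _ _ _ (by simp)
      simp [List.ofFn_succ, h, h0, mul_assoc]
    · obtain ⟨c, hc⟩ := ih i (fun k => x k.succ)
      refine ⟨c, ?_⟩
      have h : ∀ m : Fin n, i.succ.contractNth (· * ·) x m.succ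
          = i.contractNth (· * ·) (fun k => x k.succ) m := by
        intro m
        simp [Fin.contractNth]
      have h0 : i.succ.contractNth (· * ·) x 0 = x 0 :=
        Fin.contractNth_apply_of_lt _ _ _ _ (by simp)
      rw [List.ofFn_succ, List.prod_cons, hc, List.ofFn_succ, List.prod_cons, h0, mul_assoc]
      simp only [h]

namespace ZeroNerve

variable {n : ℕ}

/-- `x₁`, as a nonzero element. -/
def head (x : ZeroNerve S (n + 1)) : {s : S // s ≠ 0} :=
  ⟨x.1 0, fun h => x.2 n.succ_ne_zero (by rw [List.ofFn_succ, List.prod_cons, h, zero_mul])⟩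

/-- `(x₂, …, xₙ₊₁)` -/
def tail (x : ZeroNerve S (n + 1)) : ZeroNerve S n :=
  ⟨fun i => x.1 i.succ, fun _ h =>
    x.2 n.succ_ne_zero (by rw [List.ofFn_succ, List.prod_cons, h, mul_zero])⟩

/-- With entries counted from `0`: the tuple `(x₀, …, xⱼ xⱼ₊₁, …, xₙ)` for `j < n`, and
`(x₀, …, xₙ₋₁)` for `j = n`. -/
def contract (j : Fin (n + 1)) (x : ZeroNerve S (n + 1)) : ZeroNerve S n :=
  ⟨j.contractNth (· * ·) x.1, fun _ h => by
    obtain ⟨c, hc⟩ := exists_prod_contractNth_mul j x.1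
    exact x.2 n.succ_ne_zero (by rw [hc, h, zero_mul])⟩

theorem contract_contract (x : ZeroNerve S (n + 2)) (i : Fin (n + 1)) (j : Fin (n + 2))
    (h : (j : ℕ) ≤ i) :
    (x.contract j).contract i = (x.contract i.succ).contract (Fin.castLT j (by omega)) := by
  apply Subtype.ext
  funext k
  rcases i with ⟨i, hi⟩
  rcases j with ⟨j, hj⟩
  rcases k with ⟨k, hk⟩
  simp only [ZeroNerve.contract, Fin.contractNth, Fin.castSucc_mk, Fin.succ_mk, Fin.castLT_mk]
  simp only at h
  split_ifs <;> first | rfl | omega | (simp only [mul_assoc])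

end ZeroNerve

variable (S) (A : Type w) [AddCommGroup A] [ZeroModule S A]

/-- The coboundary operator
`(∂f)(x₁, …, xₙ₊₁) = x₁ f(x₂, …, xₙ₊₁) + ∑ (-1)^i f(x₁, …, xᵢ xᵢ₊₁, …, xₙ₊₁)
  + (-1)^(n+1) f(x₁, …, xₙ)`, with the last term included in the sum. -/
def zeroCoboundary (n : ℕ) : ZeroCochain S A n →+ ZeroCochain S A (n + 1) :=
  AddMonoidHom.mk'
    (fun f x => ZeroModule.act x.head (f x.tail) +
      ∑ j : Fin (n + 1), (-1 : ℤ) ^ ((j : ℕ) + 1) • f (x.contract j))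
    (by
      intro f g
      funext x
      simp only [Pi.add_apply, ZeroModule.act_add, smul_add, Finset.sum_add_distrib]
      abel)

theorem zeroCoboundary_comp (n : ℕ)
    (f : ZeroCochain S A n) :
    zeroCoboundary S A (n + 1) (zeroCoboundary S A n f) = 0 := by
  have act_sum : ∀ (s : {s : S // s ≠ 0}) (m : ℕ) (e : Fin m → ℤ) (g : Fin m → A),
      ZeroModule.act s (∑ j, e j • g j) = ∑ j, e j • ZeroModule.act s (g j) := by
    intro s m e g
    have := map_sum (AddMonoidHom.mk' (ZeroModule.act (A := A) s) (ZeroModule.act_add s))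
      (fun j => e j • g j) Finset.univ
    simp only [map_zsmul] at this
    exact this
  funext x
  have key : ∑ j : Fin (n + 2), (-1 : ℤ) ^ ((j : ℕ) + 1) • ∑ i : Fin (n + 1),
      (-1 : ℤ) ^ ((i : ℕ) + 1) • f ((x.contract j).contract i) = 0 := by
    simp only [Finset.smul_sum, smul_smul]
    rw [← Finset.sum_product', Finset.univ_product_univ]
    rw [← Finset.sum_add_sum_compl ({p : Fin (n+2) × Fin (n+1) | (p.1 : ℕ) ≤ p.2} : Finset _),
      ← eq_neg_iff_add_eq_zero, ← Finset.sum_neg_distrib]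
    refine Finset.sum_bij' (fun p hp => (p.2.succ, Fin.castLT p.1 ?_))
      (fun p hp => (p.2.castSucc, p.1.pred ?_)) ?_ ?_ ?_ ?_ ?_
    · have := (Finset.mem_filter.mp hp).2; omega
    · rintro h0
      simp [h0] at hp
    · intro p hp; simp at hp ⊢; omega
    · intro p hp; simp at hp ⊢; omega
    · rintro ⟨j, i⟩ hp; simp
    · rintro ⟨j, i⟩ hp; simp
    · rintro ⟨j, i⟩ hp
      simp only [Finset.mem_filter, Finset.mem_univ, true_and] at hp
      rw [ZeroNerve.contract_contract x i j hp, ← neg_smul]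
      congr 1
      simp [pow_succ, mul_comm]
  have h0 : ∀ j : Fin (n + 1), (x.contract j.succ).head = x.head := fun j =>
    Subtype.ext (by simp [ZeroNerve.head, ZeroNerve.contract, Fin.contractNth])
  have h1 : ∀ j : Fin (n + 1), (x.contract j.succ).tail = x.tail.contract j := fun j => by
    apply Subtype.ext; funext k
    simp [ZeroNerve.tail, ZeroNerve.contract, Fin.contractNth]
  have h2 : (x.contract 0).tail = x.tail.tail := by
    apply Subtype.ext; funext k
    simp [ZeroNerve.tail, ZeroNerve.contract, Fin.contractNth]
  have h3 : x.head.1 * x.tail.head.1 = (x.contract 0).head.1 :=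
    by simp [ZeroNerve.head, ZeroNerve.tail, ZeroNerve.contract, Fin.contractNth]
  have h4 : ZeroModule.act x.head (ZeroModule.act x.tail.head (f x.tail.tail))
      = ZeroModule.act (x.contract 0).head (f x.tail.tail) := by
    rw [ZeroModule.act_act _ _ (h3 ▸ (x.contract 0).head.2)]
    simp only [h3]
  simp only [zeroCoboundary, AddMonoidHom.mk'_apply, ZeroModule.act_add, act_sum, smul_add,
    Finset.sum_add_distrib, key, h4, Pi.zero_apply]
  rw [Fin.sum_univ_succ (n := n + 1)]
  simp [h0, h1, h2, pow_succ]
  abel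

/-- The `n`-dimensional 0-cocycles. -/
def zeroCocycles (n : ℕ) : AddSubgroup (ZeroCochain S A n) :=
  (zeroCoboundary S A n).ker

/-- The `n`-dimensional 0-coboundaries. -/
def zeroCoboundaries : (n : ℕ) → AddSubgroup (ZeroCochain S A n)
  | 0 => ⊥
  | n + 1 => (zeroCoboundary S A n).range

theorem zeroCoboundaries_le_zeroCocycles (n : ℕ) :
    zeroCoboundaries S A n ≤ zeroCocycles S A n := by
  cases n with
  | zero => exact bot_le
  | succ n =>
    rintro _ ⟨f, rfl⟩
    exact zeroCoboundary_comp S A n f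

/-- The 0-cohomology group: 0-cocycles modulo 0-coboundaries. -/
abbrev ZeroCohomology (n : ℕ) : Type (max u w) :=
  zeroCocycles S A n ⧸ (zeroCoboundaries S A n).addSubgroupOf (zeroCocycles S A n)

/-- The 0-cohomological dimension: the least `n` such that the `(n+1)`-st 0-cohomology group
vanishes for every 0-module (`⊤` if there is no such `n`). -/
noncomputable def zeroCohomologicalDimension : ℕ∞ :=
  ⨅ (n : ℕ) (_ : ∀ (B : Type w) [AddCommGroup B] [ZeroModule S B],
    Subsingleton (ZeroCohomology S B (n + 1))), (n : ℕ∞)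

end Cohomology

/-! ### Projective representations -/

section Projective

variable {S : Type u} [Mul S] (K : Type k) [Field K] {R : Type l} [Ring R] [Algebra K R]

/-- A map `Γ` from a semigroup to a `K`-algebra `R` (such as the matrix algebra of degree `n`) is a
projective representation if `Γ(xy)` and `Γ(x)Γ(y)` vanish simultaneously and there is a factor set
`ρ`, a partial map to `Kˣ` defined where `Γ(xy) ≠ 0`, with `Γ(x)Γ(y) = ρ(x,y) Γ(xy)`. -/
def IsProjectiveRep (Γ : S → R) : Prop :=
  (∀ x y : S, Γ (x * y) = 0 ↔ Γ x * Γ y = 0) ∧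
  ∃ ρ : {p : S × S // Γ (p.1 * p.2) ≠ 0} → Kˣ,
    ∀ p, Γ p.1.1 * Γ p.1.2 = (ρ p : K) • Γ (p.1.1 * p.1.2)

/-- Two maps to `R` are equivalent if they choose different representatives of the same classes
modulo multiplication by nonzero scalars. -/
def ProjectivelyEquivalent (Γ Γ' : S → R) : Prop :=
  ∃ c : S → Kˣ, ∀ x, Γ x = (c x : K) • Γ' x

/-- `Γ` is equivalent to a linear representation, i.e. to a semigroup homomorphism into the
multiplicative semigroup of `R`. -/
def IsLinearizable (Γ : S → R) : Prop :=
  ∃ Δ : S →ₙ* R, ProjectivelyEquivalent K Γ Δ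

end Projective

/-!
A 0-free monoid is the image of a free monoid under a homomorphism which is bijective over the
nonzero elements, and both halves of the theorem come from recursion along words.

*Cohomology.* Let `e` be the action of `1`, which need not be the identity. For a cocycle `f` of
positive degree, the cochain `y ↦ f(1, y) - e f(1, y)` has coboundary `e f - f`, so `f` is
cohomologous to `e f`. If `e f = f` and `f` has degree at least `2`, put `g(1, y) = f(1, 1, y)` and
`g(a w, y) = a g(w, y) - f(a, w, y)` for letters `a`. Then `∂g - f` is a cocycle which vanishes when
its first argument is `1` or a letter, and the cocycle identity propagates this to all words.

*Representations.* A projective representation is a map which is multiplicative up to nonzero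
scalars. If `Γ 0 ≠ 0`, then `Γ 0` is a common eigenvector for the left multiplications by the `Γ x`,
and dividing by the eigenvalues linearizes `Γ`. If `Γ 0 = 0`, the letters can be sent to their own
values under `Γ`, with `1` sent to the idempotent proportional to `Γ 1`; the resulting homomorphism
from the free monoid is proportional to `Γ`, so it vanishes wherever the word evaluates to `0` and
descends to the 0-free monoid.
-/

/-! ### Presentations of 0-free monoids -/

/-- A homomorphism from a free monoid exhibits `M` as a 0-free monoid if it restricts to a bijection
from the words with nonzero image onto the nonzero elements. It need not attain `0`, as in the case
of a free monoid with an adjoined zero. -/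
def IsZeroFreePresentation {M : Type u} [MonoidWithZero M] {X : Type v} (φ : FreeMonoid X →* M) :
    Prop :=
  Set.BijOn φ (φ ⁻¹' {0}ᶜ) {0}ᶜ

theorem reesCon_mulEquiv_mk_eq_zero {S : Type v} {M : Type u} [Mul S] [MulZeroClass M] {I : Set S}
    (hI : IsTwoSidedIdeal I) (e : M ≃* (reesCon I hI).Quotient) {i : S} (hi : i ∈ I) :
    e.symm (i : (reesCon I hI).Quotient) = 0 := by
  obtain ⟨z, hz⟩ := Quotient.exists_rep (e 0)
  have absorb : (i : (reesCon I hI).Quotient) = e 0 * i := by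
    rw [← hz]
    exact (Con.eq _).2 (Or.inr ⟨hi, (hI.2 i hi z).1⟩)
  rw [absorb, map_mul, e.symm_apply_apply, zero_mul]

theorem isZeroFreePresentation_reesCon {M : Type u} [MonoidWithZero M] {X : Type v}
    {I : Set (FreeMonoid X)} (hI : IsTwoSidedIdeal I) (e : M ≃* (reesCon I hI).Quotient) :
    IsZeroFreePresentation (e.symm.toMonoidHom.comp (reesCon I hI).mk') := by
  refine ⟨Set.mapsTo_preimage _ _, fun u hu v _ huv => ?_, fun m hm => ?_⟩
  · rcases (Con.eq (reesCon I hI)).1 (e.symm.injective huv) with h | ⟨huI, -⟩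
    · exact h
    · exact absurd (reesCon_mulEquiv_mk_eq_zero hI e huI) hu
  · obtain ⟨w, hw⟩ := Con.mk'_surjective (c := reesCon I hI) (e m)
    have hwm : e.symm ((reesCon I hI).mk' w) = m := by rw [hw, e.symm_apply_apply]
    exact ⟨w, fun h => hm (hwm.symm.trans h), hwm⟩

theorem isZeroFreePresentation_withZero {M : Type u} [MonoidWithZero M] {X : Type v}
    (e : M ≃* WithZero (FreeMonoid X)) :
    IsZeroFreePresentation (e.symm.toMonoidHom.comp WithZero.coeMonoidHom) := by
  refine ⟨Set.mapsTo_preimage _ _, fun u _ v _ huv => WithZero.coe_injective (e.symm.injective huv),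
    fun m hm => ?_⟩
  obtain ⟨w, hw⟩ := WithZero.ne_zero_iff_exists.1 ((map_ne_zero_iff e e.injective).2 hm)
  have hwm : e.symm w = m := by rw [hw, e.symm_apply_apply]
  exact ⟨w, fun h => hm (hwm.symm.trans h), hwm⟩

theorem IsZeroFree.exists_presentation {M : Type u} [MonoidWithZero M]
    (hM : IsZeroFree.{u, v} M) :
    ∃ (X : Type v) (φ : FreeMonoid X →* M), IsZeroFreePresentation φ := by
  obtain ⟨X, ⟨I, hI, ⟨e⟩⟩ | ⟨⟨e⟩⟩⟩ := hM
  · exact ⟨X, _, isZeroFreePresentation_reesCon hI e⟩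
  · exact ⟨X, _, isZeroFreePresentation_withZero e⟩

/-! ### Cochains as functions on all tuples -/

section Tuples

variable {α : Type u} {n : ℕ}

theorem contractNth_zero_cons (op : α → α → α) (a : α) (z : Fin (n + 1) → α) :
    (0 : Fin (n + 2)).contractNth op (Fin.cons a z : Fin (n + 2) → α)
      = Fin.cons (op a (z 0)) (Fin.tail z) := by
  funext k
  refine Fin.cases ?_ (fun k => ?_) k <;> simp [Fin.contractNth, Fin.tail]

theorem contractNth_succ_cons (op : α → α → α) (j : Fin (n + 1)) (a : α) (z : Fin (n + 1) → α) :
    j.succ.contractNth op (Fin.cons a z : Fin (n + 2) → α) = Fin.cons a (j.contractNth op z) := by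
  funext k
  refine Fin.cases ?_ (fun k => ?_) k <;> simp [Fin.contractNth]

theorem prod_ofFn_cons [Monoid α] (a : α) (y : Fin n → α) :
    (List.ofFn (Fin.cons a y : Fin (n + 1) → α)).prod = a * (List.ofFn y).prod := by
  simp [List.ofFn_succ]

theorem mul_prod_contractNth_ne_zero [MonoidWithZero α] (j : Fin (n + 1)) {a : α}
    {z : Fin (n + 1) → α} (h : a * (List.ofFn z).prod ≠ 0) :
    a * (List.ofFn (j.contractNth (· * ·) z)).prod ≠ 0 := by
  obtain ⟨c, hc⟩ := exists_prod_contractNth_mul j z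
  rw [hc, ← mul_assoc] at h
  exact left_ne_zero_of_mul h

end Tuples

namespace ZeroModule

variable {A : Type w} [AddCommGroup A]

section Semigroup

variable {S : Type u} [SemigroupWithZero S] [ZeroModule S A]

open Classical in
/-- The action of `S \ 0` on a 0-module, extended to all of `S` by letting `0` act as zero, so that
no proof of `s ≠ 0` has to be carried along. -/
noncomputable def actHom (s : S) : A →+ A :=
  if h : s ≠ 0 then AddMonoidHom.mk' (act ⟨s, h⟩) (act_add _) else 0

theorem actHom_coe (s : {s : S // s ≠ 0}) (a : A) : actHom s.1 a = act s a := by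
  simp [actHom, s.2]

theorem actHom_zero (a : A) : actHom (0 : S) a = 0 := by
  simp [actHom]

theorem actHom_actHom {s t : S} (h : s * t ≠ 0) (a : A) :
    actHom s (actHom t a) = actHom (s * t) a := by
  rw [actHom_coe ⟨s, left_ne_zero_of_mul h⟩, actHom_coe ⟨t, right_ne_zero_of_mul h⟩,
    actHom_coe ⟨s * t, h⟩, act_act]

end Semigroup

variable {S : Type u} [MonoidWithZero S] [ZeroModule S A]

theorem actHom_one_actHom (s : S) (a : A) : actHom (1 : S) (actHom s a) = actHom s a := by
  rcases eq_or_ne s 0 with rfl | h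
  · rw [actHom_zero, map_zero]
  · rw [actHom_actHom (by rwa [one_mul]), one_mul]

theorem actHom_actHom_one (s : S) (a : A) : actHom s (actHom (1 : S) a) = actHom s a := by
  rcases eq_or_ne s 0 with rfl | h
  · rw [actHom_zero, actHom_zero]
  · rw [actHom_actHom (by rwa [mul_one]), mul_one]

end ZeroModule

open ZeroModule (actHom)

namespace ZeroCochain

variable {S : Type u} [MonoidWithZero S] {A : Type w} [AddCommGroup A] {n : ℕ}

/-- The extension by zero of a cochain to all tuples, which lets cochains be evaluated at
`Fin.cons a z` without a proof that the product is nonzero. -/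
noncomputable def extend : ZeroCochain S A n →+ ((Fin n → S) → A) :=
  Function.ExtendByZero.hom A Subtype.val

theorem extend_val (f : ZeroCochain S A n) (x : ZeroNerve S n) : extend f x.1 = f x :=
  Subtype.val_injective.extend_apply f (0 : (Fin n → S) → A) x

theorem extend_of_prod_eq_zero (f : ZeroCochain S A (n + 1)) {x : Fin (n + 1) → S}
    (h : (List.ofFn x).prod = 0) : extend f x = 0 :=
  Function.extend_apply' f (0 : (Fin (n + 1) → S) → A) x fun ⟨y, hy⟩ =>
    y.2 n.succ_ne_zero ((congrArg (fun t => (List.ofFn t).prod) hy).trans h)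

theorem extend_cons_of_mul_eq_zero (f : ZeroCochain S A (n + 1)) {a : S} {y : Fin n → S}
    (h : a * (List.ofFn y).prod = 0) : extend f (Fin.cons a y) = 0 :=
  extend_of_prod_eq_zero f (by rwa [prod_ofFn_cons])

theorem map_extend_eq_self {f : ZeroCochain S A n} {ψ : A →+ A} (hψ : ∀ x, ψ (f x) = f x)
    (x : Fin n → S) : ψ (extend f x) = extend f x := by
  by_cases hx : ∃ y : ZeroNerve S n, y.1 = x
  · obtain ⟨y, rfl⟩ := hx
    rw [extend_val, hψ]
  · have hfx : extend f x = 0 := Function.extend_apply' f (0 : (Fin n → S) → A) x hx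
    rw [hfx, map_zero]

variable [ZeroModule S A]

theorem zeroCoboundary_apply (f : ZeroCochain S A n) (x : ZeroNerve S (n + 1)) :
    zeroCoboundary S A n f x
      = actHom (x.1 0) (extend f (Fin.tail x.1))
        + ∑ j : Fin (n + 1), (-1 : ℤ) ^ ((j : ℕ) + 1) •
          extend f (j.contractNth (· * ·) x.1) := by
  have h_head : actHom (x.1 0) (extend f (Fin.tail x.1)) = ZeroModule.act x.head (f x.tail) :=
    (ZeroModule.actHom_coe x.head _).trans (congrArg _ (extend_val f x.tail))
  have h_face (j : Fin (n + 1)) : extend f (j.contractNth (· * ·) x.1) = f (x.contract j) :=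
    extend_val f (x.contract j)
  simp only [h_head, h_face]
  rfl

theorem extend_zeroCoboundary_cons (f : ZeroCochain S A (n + 1)) {a : S} {z : Fin (n + 1) → S}
    (h : a * (List.ofFn z).prod ≠ 0) :
    extend (zeroCoboundary S A (n + 1) f) (Fin.cons a z)
      = actHom a (extend f z) - extend f (Fin.cons (a * z 0) (Fin.tail z))
        - ∑ j : Fin (n + 1), (-1 : ℤ) ^ ((j : ℕ) + 1) •
          extend f (Fin.cons a (j.contractNth (· * ·) z)) := by
  let x : ZeroNerve S (n + 2) := ⟨Fin.cons a z, fun _ => by rwa [prod_ofFn_cons]⟩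
  rw [show Fin.cons a z = x.1 from rfl, extend_val, zeroCoboundary_apply, Fin.sum_univ_succ]
  simp only [x, contractNth_zero_cons, contractNth_succ_cons, Fin.cons_zero, Fin.tail_cons,
    Fin.val_zero, Fin.val_succ, pow_succ _ (_ + 1), zero_add, pow_one, mul_neg, mul_one, neg_smul,
    one_smul, Finset.sum_neg_distrib]
  abel

end ZeroCochain

/-! ### Identities for cocycles -/

section Cocycles

open ZeroCochain

variable {S : Type u} [MonoidWithZero S] {A : Type w} [AddCommGroup A] [ZeroModule S A] {n : ℕ}

theorem exists_zeroCoboundary_eq_actHom_one_sub {f : ZeroCochain S A (n + 1)}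
    (hf : zeroCoboundary S A (n + 1) f = 0) :
    ∃ g : ZeroCochain S A n, ∀ x, zeroCoboundary S A n g x = actHom (1 : S) (f x) - f x := by
  let ψ : A →+ A := AddMonoidHom.id A - actHom (1 : S)
  have hψ (s : S) (a : A) : actHom s (ψ a) = 0 := by
    rw [AddMonoidHom.sub_apply, map_sub, ZeroModule.actHom_actHom_one, AddMonoidHom.id_apply,
      sub_self]
  refine ⟨fun y => ψ (extend f (Fin.cons 1 y.1)), fun x => ?_⟩
  have cocycle := extend_zeroCoboundary_cons f (a := 1) (z := x.1)
    (by rw [one_mul]; exact x.2 n.succ_ne_zero)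
  rw [hf, map_zero, Pi.zero_apply, one_mul, Fin.cons_self_tail, extend_val, eq_comm,
    sub_eq_zero] at cocycle
  calc _ = ZeroModule.act x.head (ψ (extend f (Fin.cons 1 x.tail.1)))
        + ∑ j : Fin (n + 1), (-1 : ℤ) ^ ((j : ℕ) + 1) •
          ψ (extend f (Fin.cons 1 (j.contractNth (· * ·) x.1))) := rfl
    _ = ψ (actHom (1 : S) (f x) - f x) := by
      rw [← ZeroModule.actHom_coe, hψ, zero_add, cocycle]
      simp only [map_sum, map_zsmul]
    _ = actHom (1 : S) (f x) - f x := by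
      simp only [ψ, AddMonoidHom.sub_apply, AddMonoidHom.id_apply, map_sub,
        ZeroModule.actHom_actHom_one]
      abel

/-- The cocycle identity at `(a, 1, z)`. -/
theorem sum_extend_cons_cons_one_contractNth {f : ZeroCochain S A (n + 2)}
    (hf : zeroCoboundary S A (n + 2) f = 0) {a : S} {z : Fin (n + 1) → S}
    (h : a * (List.ofFn z).prod ≠ 0) :
    ∑ j : Fin (n + 1), (-1 : ℤ) ^ ((j : ℕ) + 1) •
        extend f (Fin.cons a (Fin.cons 1 (j.contractNth (· * ·) z)))
      = -actHom a (extend f (Fin.cons 1 z)) := by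
  have cocycle := extend_zeroCoboundary_cons f (z := (Fin.cons 1 z : Fin (n + 2) → S))
    (a := a) (by rwa [prod_ofFn_cons, one_mul])
  rw [hf, map_zero, Fin.sum_univ_succ] at cocycle
  simp only [Pi.zero_apply, contractNth_zero_cons, contractNth_succ_cons, Fin.cons_zero,
    Fin.tail_cons, Fin.cons_self_tail, mul_one, one_mul, Fin.val_zero, Fin.val_succ,
    pow_succ _ (_ + 1), zero_add, pow_one, mul_neg, neg_smul, one_smul,
    Finset.sum_neg_distrib] at cocycle
  rw [eq_neg_iff_add_eq_zero, cocycle, ← neg_add, sub_neg_eq_add, ← add_assoc, sub_add_cancel,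
    add_comm]

theorem extend_cons_mul_eq_zero {f : ZeroCochain S A (n + 1)}
    (hf : zeroCoboundary S A (n + 1) f = 0) {a b : S}
    (ha : ∀ y, extend f (Fin.cons a y) = 0) (hb : ∀ y, extend f (Fin.cons b y) = 0)
    (y : Fin n → S) : extend f (Fin.cons (a * b) y) = 0 := by
  by_cases h : a * b * (List.ofFn y).prod = 0
  · exact extend_cons_of_mul_eq_zero f h
  · have cocycle := extend_zeroCoboundary_cons f (a := a) (z := Fin.cons b y)
      (by rwa [prod_ofFn_cons, ← mul_assoc])
    simpa [hf, ha, hb] using cocycle.symm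

end Cocycles

/-! ### Primitives along words -/

namespace IsZeroFreePresentation

open ZeroCochain

variable {M : Type u} [MonoidWithZero M] {X : Type v} {φ : FreeMonoid X →* M}
  {A : Type w} [AddCommGroup A] {n : ℕ}

theorem exists_cons_eq (hφ : IsZeroFreePresentation φ) {z : Fin (n + 1) → M}
    (hz : (List.ofFn z).prod ≠ 0) : ∃ w y, z = Fin.cons (φ w) y := by
  rw [List.ofFn_succ, List.prod_cons] at hz
  obtain ⟨w, -, hw⟩ := hφ.surjOn (left_ne_zero_of_mul hz)
  exact ⟨w, Fin.tail z, by rw [hw, Fin.cons_self_tail]⟩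

theorem exists_extend_cons_eq (hφ : IsZeroFreePresentation φ)
    (h : FreeMonoid X → (Fin n → M) → A) :
    ∃ g : ZeroCochain M A (n + 1), ∀ w y, φ w * (List.ofFn y).prod ≠ 0 →
      extend g (Fin.cons (φ w) y) = h w y := by
  let word : M → FreeMonoid X := Function.invFunOn φ (φ ⁻¹' {0}ᶜ)
  refine ⟨fun x => h (word (x.1 0)) (Fin.tail x.1), fun w y hwy => ?_⟩
  have hword : word (φ w) = w := hφ.invOn_invFunOn.1 (left_ne_zero_of_mul hwy)
  let x : ZeroNerve M (n + 1) := ⟨Fin.cons (φ w) y, fun _ => by rwa [prod_ofFn_cons]⟩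
  refine (extend_val _ x).trans ?_
  simp only [x, Fin.cons_zero, Fin.tail_cons, hword]

variable [ZeroModule M A]

theorem eq_zero_of_letters (hφ : IsZeroFreePresentation φ) {f : ZeroCochain M A (n + 1)}
    (hf : zeroCoboundary M A (n + 1) f = 0) (h_one : ∀ y, extend f (Fin.cons 1 y) = 0)
    (h_letter : ∀ a y, extend f (Fin.cons (φ (FreeMonoid.of a)) y) = 0) : f = 0 := by
  have h_word (w : FreeMonoid X) : ∀ y, extend f (Fin.cons (φ w) y) = 0 := by
    induction w using FreeMonoid.inductionOn with
    | one => rwa [map_one]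
    | of a => exact h_letter a
    | mul u v hu hv => rw [map_mul]; exact extend_cons_mul_eq_zero hf hu hv
  funext x
  obtain ⟨w, y, hx⟩ := hφ.exists_cons_eq (x.2 n.succ_ne_zero)
  rw [← extend_val f x, hx, h_word, Pi.zero_apply]

/-- The value at `(φ w, y)` of a cochain whose coboundary is `f`, when `f` is a cocycle fixed by the
action of `1`. -/
noncomputable def wordPrimitive (φ : FreeMonoid X →* M) (f : ZeroCochain M A (n + 2))
    (y : Fin n → M) (w : FreeMonoid X) : A :=
  FreeMonoid.recOn w (extend f (Fin.cons 1 (Fin.cons 1 y))) fun a w r =>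
    actHom (φ (FreeMonoid.of a)) r - extend f (Fin.cons (φ (FreeMonoid.of a)) (Fin.cons (φ w) y))

theorem wordPrimitive_one (f : ZeroCochain M A (n + 2)) (y : Fin n → M) :
    wordPrimitive φ f y 1 = extend f (Fin.cons 1 (Fin.cons 1 y)) :=
  rfl

theorem wordPrimitive_of_mul (f : ZeroCochain M A (n + 2)) (y : Fin n → M) (a : X)
    (w : FreeMonoid X) :
    wordPrimitive φ f y (FreeMonoid.of a * w)
      = actHom (φ (FreeMonoid.of a)) (wordPrimitive φ f y w)
        - extend f (Fin.cons (φ (FreeMonoid.of a)) (Fin.cons (φ w) y)) :=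
  rfl

theorem actHom_one_wordPrimitive {f : ZeroCochain M A (n + 2)}
    (hf : ∀ x, actHom (1 : M) (f x) = f x) (y : Fin n → M) (w : FreeMonoid X) :
    actHom (1 : M) (wordPrimitive φ f y w) = wordPrimitive φ f y w := by
  cases w using FreeMonoid.casesOn with
  | one => rw [wordPrimitive_one, map_extend_eq_self hf]
  | of_mul a w =>
    rw [wordPrimitive_of_mul, map_sub, ZeroModule.actHom_one_actHom, map_extend_eq_self hf]

variable {f : ZeroCochain M A (n + 2)} {g : ZeroCochain M A (n + 1)}

theorem extend_zeroCoboundary_cons_one (hφ : IsZeroFreePresentation φ)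
    (hf : zeroCoboundary M A (n + 2) f = 0) (hfe : ∀ x, actHom (1 : M) (f x) = f x)
    (hg : ∀ w y, φ w * (List.ofFn y).prod ≠ 0 →
      extend g (Fin.cons (φ w) y) = wordPrimitive φ f y w)
    (z : Fin (n + 1) → M) :
    extend (zeroCoboundary M A (n + 1) g) (Fin.cons 1 z) = extend f (Fin.cons 1 z) := by
  by_cases hz : 1 * (List.ofFn z).prod = 0
  · rw [extend_cons_of_mul_eq_zero _ hz, extend_cons_of_mul_eq_zero _ hz]
  have g_one (j : Fin (n + 1)) : extend g (Fin.cons 1 (j.contractNth (· * ·) z))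
      = extend f (Fin.cons 1 (Fin.cons 1 (j.contractNth (· * ·) z))) := by
    have := hg 1 _ (by rw [map_one]; exact mul_prod_contractNth_ne_zero j hz)
    rwa [map_one] at this
  have g_unital : actHom (1 : M) (extend g z) = extend g z := by
    obtain ⟨w, y, rfl⟩ := hφ.exists_cons_eq (right_ne_zero_of_mul hz)
    rw [prod_ofFn_cons, one_mul] at hz
    rw [hg w y hz, actHom_one_wordPrimitive hfe]
  rw [extend_zeroCoboundary_cons g hz]
  simp only [g_one]
  rw [sum_extend_cons_cons_one_contractNth hf hz, g_unital, one_mul, Fin.cons_self_tail,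
    map_extend_eq_self hfe, sub_self, zero_sub, neg_neg]

theorem extend_zeroCoboundary_cons_of (hφ : IsZeroFreePresentation φ)
    (hf : zeroCoboundary M A (n + 2) f = 0)
    (hg : ∀ w y, φ w * (List.ofFn y).prod ≠ 0 →
      extend g (Fin.cons (φ w) y) = wordPrimitive φ f y w)
    (a : X) (z : Fin (n + 1) → M) :
    extend (zeroCoboundary M A (n + 1) g) (Fin.cons (φ (FreeMonoid.of a)) z)
      = extend f (Fin.cons (φ (FreeMonoid.of a)) z) := by
  by_cases hz : φ (FreeMonoid.of a) * (List.ofFn z).prod = 0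
  · rw [extend_cons_of_mul_eq_zero _ hz, extend_cons_of_mul_eq_zero _ hz]
  have hz_one : 1 * (List.ofFn z).prod ≠ 0 := by
    rw [one_mul]; exact right_ne_zero_of_mul hz
  have g_letter (j : Fin (n + 1)) :
      extend g (Fin.cons (φ (FreeMonoid.of a)) (j.contractNth (· * ·) z))
        = actHom (φ (FreeMonoid.of a))
            (extend f (Fin.cons 1 (Fin.cons 1 (j.contractNth (· * ·) z))))
          - extend f (Fin.cons (φ (FreeMonoid.of a)) (Fin.cons 1 (j.contractNth (· * ·) z))) := by
    rw [hg _ _ (mul_prod_contractNth_ne_zero j hz), ← mul_one (FreeMonoid.of a),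
      wordPrimitive_of_mul, wordPrimitive_one, map_one, mul_one]
  have g_recursion : extend g (Fin.cons (φ (FreeMonoid.of a) * z 0) (Fin.tail z))
      = actHom (φ (FreeMonoid.of a)) (extend g z)
        - extend f (Fin.cons (φ (FreeMonoid.of a)) z) := by
    obtain ⟨w, y, rfl⟩ := hφ.exists_cons_eq (right_ne_zero_of_mul hz)
    rw [prod_ofFn_cons] at hz
    rw [Fin.cons_zero, Fin.tail_cons, ← map_mul,
      hg _ y (by rwa [map_mul, mul_assoc]), hg w y (right_ne_zero_of_mul hz),
      wordPrimitive_of_mul]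
  rw [extend_zeroCoboundary_cons g hz, g_recursion]
  simp only [g_letter, smul_sub, Finset.sum_sub_distrib, ← map_zsmul, ← map_sum]
  rw [sum_extend_cons_cons_one_contractNth hf hz, sum_extend_cons_cons_one_contractNth hf hz_one,
    map_neg, ZeroModule.actHom_actHom_one]
  abel

theorem exists_zeroCoboundary_eq (hφ : IsZeroFreePresentation φ)
    (hf : zeroCoboundary M A (n + 2) f = 0) (hfe : ∀ x, actHom (1 : M) (f x) = f x) :
    ∃ g, zeroCoboundary M A (n + 1) g = f := by
  obtain ⟨g, hg⟩ := hφ.exists_extend_cons_eq fun w y => wordPrimitive φ f y w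
  refine ⟨g, sub_eq_zero.1 (hφ.eq_zero_of_letters ?_ (fun z => ?_) fun a z => ?_)⟩
  · rw [map_sub, zeroCoboundary_comp, hf, sub_zero]
  · rw [map_sub, Pi.sub_apply, hφ.extend_zeroCoboundary_cons_one hf hfe hg, sub_self]
  · rw [map_sub, Pi.sub_apply, hφ.extend_zeroCoboundary_cons_of hf hg, sub_self]

theorem subsingleton_zeroCohomology (hφ : IsZeroFreePresentation φ) (n : ℕ) :
    Subsingleton (ZeroCohomology M A (n + 2)) := by
  refine QuotientAddGroup.subsingleton_iff.2 (AddSubgroup.addSubgroupOf_eq_top.2 fun f hf => ?_)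
  obtain ⟨g, hg⟩ := exists_zeroCoboundary_eq_actHom_one_sub hf
  have hg' : zeroCoboundary M A (n + 1) g = (fun x => actHom (1 : M) (f x)) - f := funext hg
  obtain ⟨h, hh⟩ := hφ.exists_zeroCoboundary_eq (f := fun x => actHom (1 : M) (f x))
    (by rw [← sub_add_cancel (fun x => actHom (1 : M) (f x)) f, ← hg', map_add,
      zeroCoboundary_comp, zero_add]; exact hf)
    fun x => ZeroModule.actHom_one_actHom 1 (f x)
  exact ⟨h - g, by rw [map_sub, hh, hg', sub_sub_cancel]⟩

end IsZeroFreePresentation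

/-! ### Projective representations -/

section Projective

variable (K : Type k) [Field K] (R : Type l) [Ring R] [Algebra K R]

/-- Proportionality by nonzero scalars. A projective representation is a map to `R` which is
multiplicative modulo this congruence. -/
def proportionalCon : Con R where
  toSetoid := MulAction.orbitRel Kˣ R
  mul' := by
    rintro _ b _ d ⟨s, rfl⟩ ⟨t, rfl⟩
    exact ⟨s * t, (smul_mul_smul_comm s b t d).symm⟩

variable {K R}

theorem proportionalCon_iff {r r' : R} : proportionalCon K R r r' ↔ ∃ c : Kˣ, r = c • r' :=
  exists_congr fun _ => eq_comm

theorem proportionalCon_zero_right {r : R} : proportionalCon K R r 0 ↔ r = 0 := by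
  simp [proportionalCon_iff]

variable {S : Type u}

theorem projectivelyEquivalent_iff {Γ Γ' : S → R} :
    ProjectivelyEquivalent K Γ Γ' ↔ ∀ x, proportionalCon K R (Γ x) (Γ' x) := by
  simp only [proportionalCon_iff, Classical.skolem]
  rfl

theorem isProjectiveRep_iff [Mul S] {Γ : S → R} :
    IsProjectiveRep K Γ ↔ ∀ x y, proportionalCon K R (Γ x * Γ y) (Γ (x * y)) := by
  refine ⟨fun ⟨h_zero, ρ, hρ⟩ x y => ?_, fun h => ⟨fun x y => ?_, ?_⟩⟩
  · by_cases h : Γ (x * y) = 0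
    · rw [h, (h_zero x y).1 h]
      exact (proportionalCon K R).refl 0
    · exact proportionalCon_iff.2 ⟨ρ ⟨(x, y), h⟩, hρ ⟨(x, y), h⟩⟩
  · obtain ⟨c, hc⟩ := proportionalCon_iff.1 (h x y)
    rw [hc, smul_eq_zero_iff_eq]
  · exact Classical.skolem.1 fun (p : {p : S × S // Γ (p.1 * p.2) ≠ 0}) =>
       proportionalCon_iff.1 (h p.1.1 p.1.2)

theorem IsProjectiveRep.comp [Mul S] {T : Type v} [Mul T] {Γ : S → R} (hΓ : IsProjectiveRep K Γ)
    (φ : T →ₙ* S) : IsProjectiveRep K (Γ ∘ φ) :=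
  isProjectiveRep_iff.2 fun x y => by
    simpa only [Function.comp_apply, map_mul] using isProjectiveRep_iff.1 hΓ (φ x) (φ y)

theorem IsProjectiveRep.congr [Mul S] {Γ Γ' : S → R} (hΓ : IsProjectiveRep K Γ)
    (h : ∀ x, proportionalCon K R (Γ' x) (Γ x)) : IsProjectiveRep K Γ' :=
  isProjectiveRep_iff.2 fun x y =>
    (proportionalCon K R).trans ((proportionalCon K R).mul (h x) (h y)) <|
      (proportionalCon K R).trans (isProjectiveRep_iff.1 hΓ x y) <|
        (proportionalCon K R).symm (h (x * y))

theorem IsProjectiveRep.isLinearizable_of_common_eigenvector [Mul S] {Γ : S → R}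
    (hΓ : IsProjectiveRep K Γ) {r : R} (hr : r ≠ 0)
    (h : ∀ x, proportionalCon K R (Γ x * r) r) : IsLinearizable K Γ := by
  simp only [proportionalCon_iff] at h
  choose c hc using h
  let Δ (x : S) : R := (c x)⁻¹ • Γ x
  have hΔr (x : S) : Δ x * r = r := by rw [smul_mul_assoc, hc, inv_smul_smul]
  have hΔ : IsProjectiveRep K Δ := hΓ.congr fun x => proportionalCon_iff.2 ⟨_, rfl⟩
  refine ⟨⟨Δ, fun x y => ?_⟩, c, fun x => (smul_inv_smul (c x) (Γ x)).symm⟩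
  obtain ⟨t, ht⟩ := proportionalCon_iff.1 (isProjectiveRep_iff.1 hΔ x y)
  have htr : (t : K) • r = (1 : K) • r :=
    calc t • r = Δ x * Δ y * r := by rw [ht, smul_mul_assoc, hΔr]
      _ = (1 : K) • r := by rw [mul_assoc, hΔr, hΔr, one_smul]
  have ht1 : t = 1 := Units.ext (smul_left_injective K hr htr)
  rw [ht, ht1, one_smul]

theorem IsProjectiveRep.isLinearizable_of_map_zero_ne_zero [MulZeroClass S] {Γ : S → R}
    (hΓ : IsProjectiveRep K Γ) (h0 : Γ 0 ≠ 0) : IsLinearizable K Γ :=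
  hΓ.isLinearizable_of_common_eigenvector h0 fun x => by
    simpa only [mul_zero] using isProjectiveRep_iff.1 hΓ x 0

theorem IsProjectiveRep.exists_left_identity [MulOneClass S] {Γ : S → R}
    (hΓ : IsProjectiveRep K Γ) :
    ∃ e, proportionalCon K R (Γ 1) e ∧ ∀ x, e * Γ x = Γ x := by
  have h_one (x : S) : ∃ c : Kˣ, Γ 1 * Γ x = c • Γ x := by
    simpa only [one_mul] using proportionalCon_iff.1 (isProjectiveRep_iff.1 hΓ 1 x)
  obtain ⟨t, ht⟩ := h_one 1
  refine ⟨t⁻¹ • Γ 1, proportionalCon_iff.2 ⟨t, (smul_inv_smul t (Γ 1)).symm⟩, fun x => ?_⟩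
  obtain ⟨s, hs⟩ := h_one x
  have hst : s • s • Γ x = s • t • Γ x :=
    calc s • s • Γ x = Γ 1 * (Γ 1 * Γ x) := by rw [hs, mul_smul_comm, hs]
      _ = s • t • Γ x := by rw [← mul_assoc, ht, smul_mul_assoc, hs, smul_comm]
  rw [smul_mul_assoc, hs, smul_left_cancel s hst, inv_smul_smul]

theorem IsProjectiveRep.isLinearizable_freeMonoid {X : Type v} {Γ : FreeMonoid X → R}
    (hΓ : IsProjectiveRep K Γ) : IsLinearizable K Γ := by
  obtain ⟨e, h_one, he⟩ := hΓ.exists_left_identity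
  let L : FreeMonoid X →* R := FreeMonoid.lift (Γ ∘ FreeMonoid.of)
  have hL (w : FreeMonoid X) : proportionalCon K R (Γ w) (L w * e) := by
    induction w using FreeMonoid.inductionOn' with
    | one => rwa [map_one, one_mul]
    | of_mul a w ih =>
      rw [map_mul, mul_assoc]
      exact (proportionalCon K R).trans
        ((proportionalCon K R).symm (isProjectiveRep_iff.1 hΓ (FreeMonoid.of a) w))
        ((proportionalCon K R).mul ((proportionalCon K R).refl _) ih)
  have heL (w : FreeMonoid X) : e * (L w * e) = L w * e := by
    obtain ⟨c, hc⟩ := proportionalCon_iff.1 ((proportionalCon K R).symm (hL w))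
    rw [hc, mul_smul_comm, he]
  refine ⟨⟨fun w => L w * e, fun u v => ?_⟩, projectivelyEquivalent_iff.2 hL⟩
  rw [map_mul, mul_assoc, mul_assoc, heL]

theorem IsZeroFreePresentation.isLinearizable_of_comp {M : Type u} [MonoidWithZero M] {X : Type v}
    {φ : FreeMonoid X →* M} (hφ : IsZeroFreePresentation φ) {Γ : M → R} (h0 : Γ 0 = 0)
    (hΓ : IsLinearizable K (Γ ∘ φ)) : IsLinearizable K Γ := by
  obtain ⟨Θ, hΘ⟩ := hΓ
  rw [projectivelyEquivalent_iff] at hΘ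
  have Θ_zero {w : FreeMonoid X} (hw : φ w = 0) : Θ w = 0 := by
    have hΘw := (proportionalCon K R).symm (hΘ w)
    rwa [Function.comp_apply, hw, h0, proportionalCon_zero_right] at hΘw
  have Θ_factors : Function.FactorsThrough Θ φ := fun u v huv => by
    by_cases hu : φ u = 0
    · rw [Θ_zero hu, Θ_zero (huv ▸ hu)]
    · rw [hφ.injOn hu (huv ▸ hu : φ v ≠ 0) huv]
  let Δ : M → R := Function.extend φ Θ 0
  have Δ_word (w : FreeMonoid X) : Δ (φ w) = Θ w := Θ_factors.extend_apply 0 w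
  have Δ_zero : Δ 0 = 0 := by
    by_cases h : ∃ w, φ w = 0
    · obtain ⟨w, hw⟩ := h
      rw [← hw, Δ_word, Θ_zero hw]
    · exact Function.extend_apply' _ _ _ h
  have exists_word {x : M} (hx : x ≠ 0) : ∃ w, φ w = x := (hφ.surjOn hx).imp fun _ => And.right
  refine ⟨⟨Δ, fun x y => ?_⟩, projectivelyEquivalent_iff.2 fun x => ?_⟩
  · rcases eq_or_ne x 0 with rfl | hx
    · rw [zero_mul, Δ_zero, zero_mul]
    rcases eq_or_ne y 0 with rfl | hy
    · rw [mul_zero, Δ_zero, mul_zero]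
    obtain ⟨u, rfl⟩ := exists_word hx
    obtain ⟨v, rfl⟩ := exists_word hy
    rw [← map_mul, Δ_word, Δ_word, Δ_word, map_mul]
  · rcases eq_or_ne x 0 with rfl | hx
    · rw [h0]
      exact (proportionalCon K R).symm (proportionalCon_zero_right.2 Δ_zero)
    · obtain ⟨w, rfl⟩ := exists_word hx
      change proportionalCon K R (Γ (φ w)) (Δ (φ w))
      rw [Δ_word]
      exact hΘ w

theorem IsZeroFreePresentation.isLinearizable {M : Type u} [MonoidWithZero M] {X : Type v}
    {φ : FreeMonoid X →* M} (hφ : IsZeroFreePresentation φ) {Γ : M → R}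
    (hΓ : IsProjectiveRep K Γ) : IsLinearizable K Γ := by
  by_cases h0 : Γ 0 = 0
  · exact hφ.isLinearizable_of_comp h0 (hΓ.comp φ.toMulHom).isLinearizable_freeMonoid
  · exact hΓ.isLinearizable_of_map_zero_ne_zero h0

end Projective

theorem theorem15_general {M : Type u} [MonoidWithZero M] (hM : IsZeroFree.{u, v} M) :
    zeroCohomologicalDimension.{u, w} M ≤ 1 ∧
    (∀ n : ℕ, 2 ≤ n → ∀ (A : Type w) [AddCommGroup A] [ZeroModule M A],
      Subsingleton (ZeroCohomology M A n)) ∧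
    (∀ (K : Type k) [Field K] (R : Type l) [Ring R] [Algebra K R] (Γ : M → R),
      IsProjectiveRep K Γ → IsLinearizable K Γ) := by
  obtain ⟨X, φ, hφ⟩ := hM.exists_presentation
  refine ⟨?_, fun n hn A _ _ => ?_, fun K _ R _ _ Γ => hφ.isLinearizable⟩
  · exact iInf₂_le_of_le 1 (fun B _ _ => hφ.subsingleton_zeroCohomology 0) le_rfl
  · obtain ⟨n, rfl⟩ := Nat.exists_eq_add_of_le' hn
    exact hφ.subsingleton_zeroCohomology n

theorem theorem15 {M : Type u} [MonoidWithZero M] (hM : IsZeroFree.{u, v} M) :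
    zeroCohomologicalDimension.{u, w} M ≤ 1 ∧
    (∀ n : ℕ, 2 ≤ n → ∀ (A : Type w) [AddCommGroup A] [ZeroModule M A],
      Subsingleton (ZeroCohomology M A n)) ∧
    (∀ (K : Type k) [Field K] (n : ℕ) (Γ : M → Matrix (Fin n) (Fin n) K),
      IsProjectiveRep K Γ → IsLinearizable K Γ) ∧
    (∀ (K : Type k) [Field K] (V : Type l) [AddCommGroup V] [Module K V]
      (Γ : M → Module.End K V), IsProjectiveRep K Γ → IsLinearizable K Γ) := by
  obtain ⟨h_dim, h_coh, h_end⟩ := theorem15_general.{u, v, w, k, l} hM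
  exact ⟨h_dim, h_coh, fun K _ n => (theorem15_general.{u, v, w, k, k} hM).2.2 K _,
    fun K _ V _ _ => h_end K _⟩
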